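/- There is an absolute constant $C>0$ such that the following holds for every finite simple unweighted edge-transitive graph $G=(V,E)$ with $n$ vertices (edge-transitive: for any two edges $e,f\in E$ some automorphism of $G$ maps $e$ to $f$). Orient the edges of $G$ arbitrarily. Write $b_{st}=b_s-b_t$, where $b_v\in\mathbb{R}^V$ is the indicator vector of $v$; let $B\in\mathbb{R}^{E\times V}$ be the signed edge-vertex incidence matrix, whose row at an edge $e$ directed from $u$ to $v$ is $b_{uv}^T$; let $L=B^TB$ be the Laplacian, $L^+$ its Moore–Penrose pseudoinverse, $f_{st}=BL^+b_{st}\in\mathbb{R}^E$ the electrical flow between $s,t\in V$, and $\Pi=BL^+B^T$ the transfer impedance matrix. A unit flow from $s$ to $t$ is a vector $f\in\mathbb{R}^E$ with $B^Tf=b_{st}$, and the congestion of a multicommodity flow $(f_1,\dots,f_k)$ is $\max_{e\in E}\sum_{i=1}^k|f_i(e)|$ (and $0$ if $E=\emptyset$). 1. The electrical flows form an oblivious routing scheme: for all $s,t\in V$ in the same connected component, $f_{st}$ is a unit flow from $s$ to $t$. 2. This scheme has competitive ratio at most $C\log^2 n$: for all demand pairs $(s_1,t_1),\dots,(s_k,t_k)$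 of vertices (repetitions allowed) and every multicommodity flow $(g_1,\dots,g_k)$, where $g_i$ is a unit flow from $s_i$ to $t_i$, the congestion of $(f_{s_1t_1},\dots,f_{s_kt_k})$ is at most $C\log^2 n$ times the congestion of $(g_1,\dots,g_k)$. 3. Every column sum of the entrywise absolute value of $\Pi$ is at most $C\log^2 n$: $\sum_{f\in E}|\Pi_{f,e}|\le C\log^2 n$ for every $e\in E$. -/

import Mathlib

open scoped Matrix

noncomputable section

namespace ElectricalRouting

universe u

/-- `X` is the Moore–Penrose pseudoinverse of the real matrix `A` (the four Penrose equations). -/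
structure IsMoorePenrose {m n : Type*} [Fintype m] [Fintype n]
    (A : Matrix m n ℝ) (X : Matrix n m ℝ) : Prop where
  mul_mul_self : A * X * A = A
  self_mul_mul : X * A * X = X
  symm_left : (A * X)ᵀ = A * X
  symm_right : (X * A)ᵀ = X * A

/-- The pseudoinverse is unique. -/
theorem IsMoorePenrose.unique {m n : Type*} [Fintype m] [Fintype n]
    {A : Matrix m n ℝ} {X Y : Matrix n m ℝ}
    (hX : IsMoorePenrose A X) (hY : IsMoorePenrose A Y) : X = Y := by
  have h1 : A * X = A * Y := by
    calc A * X = (A * X)ᵀ := hX.symm_left.symm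
      _ = (A * Y * (A * X))ᵀ := by rw [← Matrix.mul_assoc, hY.mul_mul_self]
      _ = A * X * (A * Y) := by rw [Matrix.transpose_mul, hX.symm_left, hY.symm_left]
      _ = A * Y := by rw [← Matrix.mul_assoc, hX.mul_mul_self]
  have h2 : X * A = Y * A := by
    calc X * A = (X * A)ᵀ := hX.symm_right.symm
      _ = (X * A * (Y * A))ᵀ := by
          rw [Matrix.mul_assoc, ← Matrix.mul_assoc A, hY.mul_mul_self]
      _ = Y * A * (X * A) := by rw [Matrix.transpose_mul, hX.symm_right, hY.symm_right]
      _ = Y * A := by rw [Matrix.mul_assoc, ← Matrix.mul_assoc A, hX.mul_mul_self]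
  calc X = X * A * X := hX.self_mul_mul.symm
    _ = Y * A * Y := by rw [h2, Matrix.mul_assoc, h1, ← Matrix.mul_assoc]
    _ = Y := hY.self_mul_mul

/-- Every real symmetric matrix has a Moore–Penrose pseudoinverse. -/
theorem exists_isMoorePenrose {n : Type*} [Fintype n] [DecidableEq n]
    (A : Matrix n n ℝ) (hA : A.IsHermitian) : ∃ X : Matrix n n ℝ, IsMoorePenrose A X := by
  obtain ⟨U, d, hU, hAd⟩ : ∃ (U : Matrix n n ℝ) (d : n → ℝ), Uᵀ * U = 1 ∧
      A = U * Matrix.diagonal d * Uᵀ := by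
    refine ⟨hA.eigenvectorUnitary, hA.eigenvalues, ?_, ?_⟩
    · have h := Unitary.coe_star_mul_self hA.eigenvectorUnitary
      rwa [Matrix.star_eq_conjTranspose, Matrix.conjTranspose_eq_transpose_of_trivial] at h
    · have h := hA.spectral_theorem
      rw [Unitary.conjStarAlgAut_apply, Matrix.star_eq_conjTranspose,
        Matrix.conjTranspose_eq_transpose_of_trivial] at h
      exact h
  have key : ∀ a b : n → ℝ, (U * Matrix.diagonal a * Uᵀ) * (U * Matrix.diagonal b * Uᵀ)
      = U * Matrix.diagonal (fun i => a i * b i) * Uᵀ := by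
    intro a b
    calc (U * Matrix.diagonal a * Uᵀ) * (U * Matrix.diagonal b * Uᵀ)
        = U * Matrix.diagonal a * (Uᵀ * U) * Matrix.diagonal b * Uᵀ := by
          simp only [Matrix.mul_assoc]
      _ = _ := by rw [hU, Matrix.mul_one, Matrix.mul_assoc U, Matrix.diagonal_mul_diagonal]
  have symm : ∀ a : n → ℝ, (U * Matrix.diagonal a * Uᵀ)ᵀ = U * Matrix.diagonal a * Uᵀ := by
    intro a
    simp [Matrix.transpose_mul, Matrix.mul_assoc]
  refine ⟨U * Matrix.diagonal (fun i => (d i)⁻¹) * Uᵀ, ?_, ?_, ?_, ?_⟩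
  · rw [hAd, key, key, funext fun i => mul_inv_mul_cancel (d i)]
  · rw [hAd, key, key, show (fun i => (d i)⁻¹ * d i * (d i)⁻¹) = fun i => (d i)⁻¹ from
      funext fun i => by simpa using mul_inv_mul_cancel (d i)⁻¹]
  · rw [hAd, key, symm]
  · rw [hAd, key, symm]

/-- The Moore–Penrose pseudoinverse `A⁺` of a real symmetric matrix. -/
def pinv {n : Type*} [Fintype n] [DecidableEq n] (A : Matrix n n ℝ) (hA : A.IsHermitian) :
    Matrix n n ℝ :=
  Classical.choose (exists_isMoorePenrose A hA)

theorem pinv_spec {n : Type*} [Fintype n] [DecidableEq n] (A : Matrix n n ℝ)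
    (hA : A.IsHermitian) : IsMoorePenrose A (pinv A hA) :=
  Classical.choose_spec (exists_isMoorePenrose A hA)

/-- A graph is edge-transitive if its automorphisms act transitively on its (undirected) edges. -/
def EdgeTransitive {V : Type u} (G : SimpleGraph V) : Prop :=
  ∀ e ∈ G.edgeSet, ∀ f ∈ G.edgeSet, ∃ φ : G ≃g G, Sym2.map φ e = f

/-- An (arbitrary) orientation of the edges: each edge `e` is directed from `tail e`
to `head e`. -/
structure Orientation {V : Type u} (G : SimpleGraph V) where
  tail : G.edgeSet → V
  head : G.edgeSet → V
  mk_eq : ∀ e : G.edgeSet, s(tail e, head e) = (e : Sym2 V)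

section

variable {V : Type u} [DecidableEq V] {G : SimpleGraph V} [Fintype G.edgeSet]

/-- The vector `b_{st} = b_s - b_t`, a difference of indicator vectors of vertices. -/
def demandVec {V : Type u} [DecidableEq V] (s t : V) : V → ℝ :=
  Pi.single s 1 - Pi.single t 1

/-- The signed edge-vertex incidence matrix `B`; the row of `e` is `b_{tail e, head e}`. -/
def incidence (o : Orientation G) : Matrix G.edgeSet V ℝ :=
  Matrix.of fun e => demandVec (o.tail e) (o.head e)

/-- The Laplacian matrix `L = Bᵀ B`. -/
def laplacian (o : Orientation G) : Matrix V V ℝ :=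
  (incidence o)ᵀ * incidence o

theorem laplacian_isHermitian (o : Orientation G) : (laplacian o).IsHermitian := by
  simp [laplacian, Matrix.IsHermitian, Matrix.conjTranspose_eq_transpose_of_trivial,
    Matrix.transpose_mul]

/-- The pseudoinverse `L⁺` of the Laplacian. -/
def laplacianPinv [Fintype V] (o : Orientation G) : Matrix V V ℝ :=
  pinv (laplacian o) (laplacian_isHermitian o)

/-- The transfer impedance matrix `Π = B L⁺ Bᵀ` of an unweighted graph. -/
def transferImpedance [Fintype V] (o : Orientation G) : Matrix G.edgeSet G.edgeSet ℝ :=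
  incidence o * laplacianPinv o * (incidence o)ᵀ

/-- The electrical flow `f_{st} = B L⁺ b_{st}`. -/
def electricalFlow [Fintype V] (o : Orientation G) (s t : V) : G.edgeSet → ℝ :=
  incidence o *ᵥ (laplacianPinv o *ᵥ demandVec s t)

/-- `f` is a unit flow from `s` to `t`. The value `f e` is the signed amount of flow along `e`
in the direction of the orientation, and `(Bᵀ f) v` is the net flow out of `v`. -/
def IsUnitFlow (o : Orientation G) (s t : V) (f : G.edgeSet → ℝ) : Prop :=
  (incidence o)ᵀ *ᵥ f = demandVec s t

/-- The congestion of a multicommodity flow `f 0, …, f (k-1)`: the maximum over the edges of the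
total amount of flow of all commodities (regardless of direction) on that edge. -/
def congestion {V : Type u} {G : SimpleGraph V} {k : ℕ} (f : Fin k → G.edgeSet → ℝ) : ℝ :=
  ⨆ e : G.edgeSet, ∑ i, |f i e|

/-- An oblivious routing scheme prescribes, for all `s`, `t` that are connected by a path,
a unit flow from `s` to `t`. -/
def IsObliviousRouting (o : Orientation G) (f : V → V → G.edgeSet → ℝ) : Prop :=
  ∀ s t : V, G.Reachable s t → IsUnitFlow o s t (f s t)

/-- The scheme `f` has competitive ratio at most `α`: for all demand pairs `(s i, t i)`, `i < k`
(repetitions allowed), routing each of them by `f` has congestion at most `α` times that of any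
multicommodity flow `g` which routes the same pairs (so of an optimal one). -/
def CompetitiveRatioLE (o : Orientation G) (f : V → V → G.edgeSet → ℝ) (α : ℝ) : Prop :=
  ∀ (k : ℕ) (s t : Fin k → V) (g : Fin k → G.edgeSet → ℝ),
    (∀ i, IsUnitFlow o (s i) (t i) (g i)) →
      congestion (fun i => f (s i) (t i)) ≤ α * congestion g

end

end ElectricalRouting

end

noncomputable section

namespace ElectricalRouting

set_option linter.unusedSectionVars false

/-! Let `W` be the lazy random walk, `D` the degree matrix and `M = ½ B D⁻¹ Bᵀ`. Then `(1 - M) B = B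
W`, and since `Π` fixes the range of `B`, it is the sum of the series `∑ M (1 - M)^t`. Moreover `M
(1 - M)^(s+r) = ½ (B W^s) D⁻¹ (B W^r)ᵀ`, so its column sums are controlled by `v_s v_r / 2`, where
`v_s` is the `ℓ¹` distance between the laws of `s`-step walks from the two ends of an edge.
Edge-transitivity makes `v_s` independent of the edge and supplies the matching bound over all edges
at a vertex (`vertexVariation_le`). Hence the column sums of `Π` are at most `∑ v_s²`.

That sum is bounded by entropy. A step of the walk averages the laws at the two ends of an edge, so
strong concavity of entropy produces a gain of order `v_s²` on each edge (`walkEntropy_succ`), while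
entropy never exceeds `log n + 1`. This yields `∑ v_s² = O(log n)`, stronger than needed. Since `Π`
maps any routing to the electrical one, its column sums bound the competitive ratio. -/

/-! ### Entropy inequalities -/

theorem two_mul_sub_sqrt_le_mul_log {a m : ℝ} (ha : 0 ≤ a) (hm : 0 < m) :
    2 * a - 2 * (√a * √m) ≤ a * Real.log a - a * Real.log m := by
  rcases ha.eq_or_lt with rfl | ha
  · simp
  -- Using `√a / √m` keeps a squared difference of square roots; with `a / m` the bounds for `a` and
  -- `b` would cancel at the midpoint.
  have h := Real.one_sub_inv_le_log_of_pos (div_pos (Real.sqrt_pos.2 ha) (Real.sqrt_pos.2 hm))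
  rw [Real.log_div (Real.sqrt_pos.2 ha).ne' (Real.sqrt_pos.2 hm).ne', Real.log_sqrt ha.le,
    Real.log_sqrt hm.le, inv_div] at h
  have h2 := mul_le_mul_of_nonneg_left h ha.le
  have h3 : a * (√m / √a) = √a * √m := by
    have := (Real.sqrt_pos.2 ha).ne'
    field_simp
    rw [Real.sq_sqrt ha.le]
  rw [mul_sub, h3] at h2
  linarith

/-- Strong midpoint concavity of `x ↦ - x log x`. -/
theorem negMulLog_midpoint {a b : ℝ} (ha : 0 ≤ a) (hb : 0 ≤ b) :
    (Real.negMulLog a + Real.negMulLog b) / 2 + (a - b) ^ 2 / (a + b) / 12 ≤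
      Real.negMulLog ((a + b) / 2) := by
  rcases (add_nonneg ha hb).eq_or_lt with h0 | h0
  · obtain rfl : a = 0 := by linarith
    obtain rfl : b = 0 := by linarith
    simp
  obtain ⟨m, hm⟩ : ∃ m, m = (a + b) / 2 := ⟨_, rfl⟩
  have hm0 : 0 < m := by linarith
  have h1 := two_mul_sub_sqrt_le_mul_log ha hm0
  have h2 := two_mul_sub_sqrt_le_mul_log hb hm0
  have hsum : a + b = 2 * m := by linarith
  rw [← hm, hsum]
  have key : (a - b) ^ 2 / (2 * m) / 6 ≤ 4 * m - 2 * (√a * √m) - 2 * (√b * √m) := by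
    rw [div_div, div_le_iff₀ (by positivity)]
    have ea := Real.sq_sqrt ha
    have eb := Real.sq_sqrt hb
    have em := Real.sq_sqrt hm0.le
    have pa := Real.sqrt_nonneg a
    have pb := Real.sqrt_nonneg b
    have pm := Real.sqrt_nonneg m
    set α := √a
    set β := √b
    set μ := √m
    -- Here `a ≤ 2m`, so `(α + μ)² ≤ 2a + 2m ≤ 6m`.
    have ka : (a - m) ^ 2 ≤ (α - μ) ^ 2 * (6 * m) := by
      have : (a - m) ^ 2 = (α - μ) ^ 2 * (α + μ) ^ 2 := by rw [← ea, ← em]; ring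
      rw [this]
      exact mul_le_mul_of_nonneg_left (by nlinarith [sq_nonneg (α - μ)]) (sq_nonneg _)
    have kb : (b - m) ^ 2 ≤ (β - μ) ^ 2 * (6 * m) := by
      have : (b - m) ^ 2 = (β - μ) ^ 2 * (β + μ) ^ 2 := by rw [← eb, ← em]; ring
      rw [this]
      exact mul_le_mul_of_nonneg_left (by nlinarith [sq_nonneg (β - μ)]) (sq_nonneg _)
    have e1 : 4 * m - 2 * (α * μ) - 2 * (β * μ) = (α - μ) ^ 2 + (β - μ) ^ 2 := by
      linarith [sq_abs (α - μ), show (α - μ) ^ 2 = a - 2 * (α * μ) + m by rw [← ea, ← em]; ring,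
        show (β - μ) ^ 2 = b - 2 * (β * μ) + m by rw [← eb, ← em]; ring]
    rw [e1]
    have e2 : (a - b) ^ 2 = 2 * (a - m) ^ 2 + 2 * (b - m) ^ 2 := by
      rw [hm]; ring
    rw [e2]
    linarith
  have e3 : (a - b) ^ 2 / (2 * m) / 12 = (a - b) ^ 2 / (2 * m) / 6 / 2 := by ring
  rw [e3]
  simp only [Real.negMulLog]
  have : a * Real.log m + b * Real.log m = 2 * m * Real.log m := by rw [← hsum]; ring
  linarith

/-- The entropy of a subprobability vector. -/
theorem sum_negMulLog_le {ι : Type*} [Fintype ι] (p : ι → ℝ) (hp : ∀ i, 0 ≤ p i)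
    (hs : ∑ i, p i ≤ 1) :
    ∑ i, Real.negMulLog (p i) ≤ Real.log (Fintype.card ι) + 1 := by
  rcases isEmpty_or_nonempty ι with h | h
  · simp
  have hn : (0 : ℝ) < Fintype.card ι := by exact_mod_cast Fintype.card_pos
  have hn1 : (1 : ℝ) ≤ Fintype.card ι := by exact_mod_cast Fintype.card_pos
  have hl := Real.log_nonneg hn1
  obtain ⟨n, hndef⟩ : ∃ n : ℝ, n = Fintype.card ι := ⟨_, rfl⟩
  rw [← hndef] at hn hn1 hl ⊢
  -- Tangent line of `negMulLog` at `1 / n`, with the term `-p i` dropped.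
  have key : ∀ i, Real.negMulLog (p i) ≤ p i * Real.log n + 1 / n := by
    intro i
    rcases (hp i).eq_or_lt with h0 | h0
    · rw [← h0]; simp [hn.le]
    · have h1 := Real.log_le_sub_one_of_pos (inv_pos.2 (mul_pos hn h0))
      rw [Real.log_inv, Real.log_mul hn.ne' h0.ne'] at h1
      have h2 := mul_le_mul_of_nonneg_left h1 h0.le
      have h3 : p i * ((n * p i)⁻¹ - 1) = 1 / n - p i := by field_simp
      rw [h3] at h2
      simp only [Real.negMulLog]
      linarith
  calc ∑ i, Real.negMulLog (p i) ≤ ∑ i, (p i * Real.log n + 1 / n) :=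
        Finset.sum_le_sum fun i _ => key i
    _ = (∑ i, p i) * Real.log n + 1 := by
        rw [Finset.sum_add_distrib, Finset.sum_mul, Finset.sum_const, Finset.card_univ,
          nsmul_eq_mul, ← hndef, mul_one_div_cancel hn.ne']
    _ ≤ _ := by nlinarith

/-- Cauchy–Schwarz, comparing the `ℓ¹` distance with the triangular discrimination. -/
theorem sq_sum_abs_sub_le {ι : Type*} [Fintype ι] (p q : ι → ℝ) (hp : ∀ i, 0 ≤ p i)
    (hq : ∀ i, 0 ≤ q i) (hps : ∑ i, p i ≤ 1) (hqs : ∑ i, q i ≤ 1) :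
    (∑ i, |p i - q i|) ^ 2 ≤ 2 * ∑ i, (p i - q i) ^ 2 / (p i + q i) := by
  have h := Finset.sum_sq_le_sum_mul_sum_of_sq_le_mul Finset.univ (r := fun i => |p i - q i|)
    (f := fun i => p i + q i) (g := fun i => (p i - q i) ^ 2 / (p i + q i))
    (fun i _ => add_nonneg (hp i) (hq i))
    (fun i _ => div_nonneg (sq_nonneg _) (add_nonneg (hp i) (hq i))) (fun i _ => by
      refine le_of_eq ?_
      rw [sq_abs]
      rcases (add_nonneg (hp i) (hq i)).eq_or_lt with h0 | h0
      · have h1 : p i = 0 := by linarith [hp i, hq i]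
        have h2 : q i = 0 := by linarith [hp i, hq i]
        simp [h1, h2]
      · field_simp)
  refine h.trans (mul_le_mul_of_nonneg_right ?_ (Finset.sum_nonneg fun i _ =>
    div_nonneg (sq_nonneg _) (add_nonneg (hp i) (hq i))))
  rw [Finset.sum_add_distrib]
  linarith

/-! ### Incidence matrices and degrees -/

section

variable {V : Type u} [DecidableEq V] {G : SimpleGraph V} [Fintype G.edgeSet]

theorem Orientation.tail_ne_head (o : Orientation G) (e : G.edgeSet) : o.tail e ≠ o.head e := by
  intro h
  have h1 := e.2
  rw [← o.mk_eq e, h] at h1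
  exact G.loopless.irrefl _ h1

theorem incidence_apply (o : Orientation G) (e : G.edgeSet) (x : V) :
    incidence o e x = (if o.tail e = x then 1 else 0) - if o.head e = x then 1 else 0 := by
  simp [incidence, demandVec, Pi.single_apply, eq_comm]

/-- The unsigned edge-vertex incidence matrix. -/
def unsignedIncidence (o : Orientation G) : Matrix G.edgeSet V ℝ :=
  Matrix.of fun e x => (if o.tail e = x then 1 else 0) + if o.head e = x then 1 else 0

theorem unsignedIncidence_apply (o : Orientation G) (e : G.edgeSet) (x : V) :
    unsignedIncidence o e x =
      (if o.tail e = x then 1 else 0) + if o.head e = x then 1 else 0 := rfl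

theorem unsignedIncidence_nonneg (o : Orientation G) (e : G.edgeSet) (x : V) :
    0 ≤ unsignedIncidence o e x := by
  rw [unsignedIncidence_apply]
  split_ifs <;> norm_num

/-- The degree of a vertex. -/
def deg (o : Orientation G) (x : V) : ℝ := ∑ e, unsignedIncidence o e x

theorem deg_nonneg (o : Orientation G) (x : V) : 0 ≤ deg o x :=
  Finset.sum_nonneg fun e _ => unsignedIncidence_nonneg o e x

theorem unsignedIncidence_eq_zero (o : Orientation G) {x : V} (hx : deg o x = 0)
    (e : G.edgeSet) : unsignedIncidence o e x = 0 :=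
  (Finset.sum_eq_zero_iff_of_nonneg fun e _ => unsignedIncidence_nonneg o e x).1 hx e
    (Finset.mem_univ e)

theorem abs_incidence (o : Orientation G) (e : G.edgeSet) (x : V) :
    |incidence o e x| = unsignedIncidence o e x := by
  rw [incidence_apply, unsignedIncidence_apply]
  have := o.tail_ne_head e
  split_ifs with h1 h2 <;> simp_all

theorem incidence_eq_zero (o : Orientation G) {x : V} (hx : deg o x = 0)
    (e : G.edgeSet) : incidence o e x = 0 := by
  rw [← abs_eq_zero, abs_incidence, unsignedIncidence_eq_zero o hx]

theorem exists_endpoint_of_deg_ne_zero (o : Orientation G) {x : V} (hx : deg o x ≠ 0) :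
    ∃ e, o.tail e = x ∨ o.head e = x := by
  obtain ⟨e, -, he⟩ := Finset.exists_ne_zero_of_sum_ne_zero hx
  refine ⟨e, ?_⟩
  by_contra! h
  exact he (by simp [unsignedIncidence_apply, h.1, h.2])

variable [Fintype V]

theorem sum_incidence_mul (o : Orientation G) (e : G.edgeSet) (q : V → ℝ) :
    ∑ x, incidence o e x * q x = q (o.tail e) - q (o.head e) := by
  simp [incidence_apply, sub_mul, Finset.sum_sub_distrib]

theorem sum_unsignedIncidence_mul (o : Orientation G) (e : G.edgeSet) (q : V → ℝ) :
    ∑ x, unsignedIncidence o e x * q x = q (o.tail e) + q (o.head e) := by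
  simp [unsignedIncidence_apply, add_mul, Finset.sum_add_distrib]

theorem sum_deg_mul (o : Orientation G) (q : V → ℝ) :
    ∑ x, deg o x * q x = ∑ e, (q (o.tail e) + q (o.head e)) := by
  simp only [deg, Finset.sum_mul]
  rw [Finset.sum_comm]
  simp only [sum_unsignedIncidence_mul]

/-! ### The lazy walk and its entropy -/

/-- The transition matrix of the lazy random walk (with zero rows at isolated vertices). -/
def walk (o : Orientation G) : Matrix V V ℝ :=
  Matrix.diagonal (fun x => (2 * deg o x)⁻¹) * ((unsignedIncidence o)ᵀ * unsignedIncidence o)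

theorem walk_mulVec (o : Orientation G) (q : V → ℝ) (x : V) :
    (walk o *ᵥ q) x = (deg o x)⁻¹ *
      ∑ e, unsignedIncidence o e x * ((q (o.tail e) + q (o.head e)) / 2) := by
  rw [walk, ← Matrix.mulVec_mulVec, Matrix.mulVec_diagonal, ← Matrix.mulVec_mulVec]
  have : ∀ e, (unsignedIncidence o *ᵥ q) e = q (o.tail e) + q (o.head e) := fun e =>
    sum_unsignedIncidence_mul o e q
  simp only [Matrix.mulVec, dotProduct, Matrix.transpose_apply] at this ⊢
  simp only [this, ← mul_div_assoc, ← Finset.sum_div]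
  rw [mul_inv]
  ring

/-- One step picks a uniform incident edge and then a uniform end of it, so a row at time `s + 1`
averages midpoints of rows at time `s`. -/
theorem walk_pow_succ_apply (o : Orientation G) (s : ℕ) (x y : V) :
    (walk o ^ (s + 1)) x y = (deg o x)⁻¹ * ∑ e, unsignedIncidence o e x *
      (((walk o ^ s) (o.tail e) y + (walk o ^ s) (o.head e) y) / 2) := by
  rw [pow_succ', ← walk_mulVec o fun z => (walk o ^ s) z y]
  rfl

theorem walk_pow_nonneg (o : Orientation G) (s : ℕ) (x y : V) : 0 ≤ (walk o ^ s) x y := by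
  induction s generalizing x with
  | zero => rw [pow_zero, Matrix.one_apply]; split_ifs <;> norm_num
  | succ s ih =>
    rw [walk_pow_succ_apply]
    refine mul_nonneg (inv_nonneg.2 (deg_nonneg o x)) (Finset.sum_nonneg fun e _ =>
      mul_nonneg (unsignedIncidence_nonneg o e x) ?_)
    linarith [ih (o.tail e), ih (o.head e)]

/-- Only an inequality, because isolated vertices have zero rows. -/
theorem sum_walk_pow_le_one (o : Orientation G) (s : ℕ) (x : V) :
    ∑ y, (walk o ^ s) x y ≤ 1 := by
  induction s generalizing x with
  | zero => simp [Matrix.one_apply]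
  | succ s ih =>
    simp only [walk_pow_succ_apply]
    rw [← Finset.mul_sum, Finset.sum_comm]
    simp only [← Finset.mul_sum, ← Finset.sum_div, Finset.sum_add_distrib]
    calc _ ≤ (deg o x)⁻¹ * ∑ e, unsignedIncidence o e x * 1 := by
          refine mul_le_mul_of_nonneg_left (Finset.sum_le_sum fun e _ =>
            mul_le_mul_of_nonneg_left ?_ (unsignedIncidence_nonneg o e x))
            (inv_nonneg.2 (deg_nonneg o x))
          linarith [ih (o.tail e), ih (o.head e)]
      _ ≤ 1 := by
          simp only [mul_one]
          exact inv_mul_le_one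

/-- The differences of the transition probabilities across the edges. -/
def edgeWalk (o : Orientation G) (s : ℕ) : Matrix G.edgeSet V ℝ := incidence o * walk o ^ s

theorem edgeWalk_apply (o : Orientation G) (s : ℕ) (e : G.edgeSet) (x : V) :
    edgeWalk o s e x = (walk o ^ s) (o.tail e) x - (walk o ^ s) (o.head e) x :=
  sum_incidence_mul o e fun z => (walk o ^ s) z x

/-- The `ℓ¹` distance between the distributions of two lazy walks started at the endpoints
of an edge. -/
def variation (o : Orientation G) (s : ℕ) (e : G.edgeSet) : ℝ := ∑ x, |edgeWalk o s e x|

theorem variation_nonneg (o : Orientation G) (s : ℕ) (e : G.edgeSet) : 0 ≤ variation o s e :=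
  Finset.sum_nonneg fun _ _ => abs_nonneg _

/-- The conditional entropy of the lazy walk, up to the normalisation of the initial
distribution. -/
def walkEntropy (o : Orientation G) (s : ℕ) : ℝ :=
  ∑ x, deg o x * ∑ y, Real.negMulLog ((walk o ^ s) x y)

/-- Jensen's inequality for the average over the edges at `x`. -/
theorem deg_mul_negMulLog_walk_le (o : Orientation G) (s : ℕ) (x y : V) :
    ∑ e, unsignedIncidence o e x *
      Real.negMulLog (((walk o ^ s) (o.tail e) y + (walk o ^ s) (o.head e) y) / 2) ≤
    deg o x * Real.negMulLog ((walk o ^ (s + 1)) x y) := by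
  rcases (deg_nonneg o x).eq_or_lt with h0 | h0
  · simp [unsignedIncidence_eq_zero o h0.symm, ← h0]
  have h := Real.concaveOn_negMulLog.le_map_sum (t := Finset.univ)
    (w := fun e => (deg o x)⁻¹ * unsignedIncidence o e x)
    (p := fun e => ((walk o ^ s) (o.tail e) y + (walk o ^ s) (o.head e) y) / 2)
    (fun e _ => mul_nonneg (inv_nonneg.2 h0.le) (unsignedIncidence_nonneg o e x))
    (by rw [← Finset.mul_sum]; exact inv_mul_cancel₀ h0.ne')
    (fun e _ => by
      have := walk_pow_nonneg o s (o.tail e) y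
      have := walk_pow_nonneg o s (o.head e) y
      simp only [Set.mem_Ici]
      linarith)
  simp only [smul_eq_mul, mul_assoc, ← Finset.mul_sum] at h
  rw [← walk_pow_succ_apply, inv_mul_le_iff₀ h0] at h
  exact h

/-- Jensen over the edges at a vertex loses nothing needed; the gain comes from the midpoint on each
edge, by `negMulLog_midpoint` and Cauchy–Schwarz. -/
theorem walkEntropy_succ (o : Orientation G) (s : ℕ) :
    walkEntropy o s + (∑ e, variation o s e ^ 2) / 12 ≤ walkEntropy o (s + 1) := by
  have hW := walk_pow_nonneg o s
  have h1 : walkEntropy o s = ∑ e, ∑ y, (Real.negMulLog ((walk o ^ s) (o.tail e) y) +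
      Real.negMulLog ((walk o ^ s) (o.head e) y)) := by
    rw [walkEntropy, sum_deg_mul]
    simp only [Finset.sum_add_distrib]
  -- Each edge is counted once from each end.
  have hF : ∀ F : G.edgeSet → V → ℝ, ∑ e, ∑ y, 2 * F e y =
      ∑ x, ∑ y, ∑ e, unsignedIncidence o e x * F e y := by
    intro F
    calc _ = ∑ y, ∑ e, ∑ x, unsignedIncidence o e x * F e y := by
          rw [Finset.sum_comm]
          simp only [fun e y => sum_unsignedIncidence_mul o e fun _ => F e y, two_mul]
      _ = ∑ y, ∑ x, ∑ e, unsignedIncidence o e x * F e y :=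
          Finset.sum_congr rfl fun y _ => Finset.sum_comm
      _ = _ := Finset.sum_comm
  have h2 : ∑ e, ∑ y, 2 *
      Real.negMulLog (((walk o ^ s) (o.tail e) y + (walk o ^ s) (o.head e) y) / 2) ≤
      walkEntropy o (s + 1) := by
    calc _ = ∑ x, ∑ y, ∑ e, unsignedIncidence o e x *
          Real.negMulLog (((walk o ^ s) (o.tail e) y + (walk o ^ s) (o.head e) y) / 2) := by
          exact hF _
      _ ≤ _ := by
          simp only [walkEntropy, Finset.mul_sum]
          exact Finset.sum_le_sum fun x _ => Finset.sum_le_sum fun y _ =>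
            deg_mul_negMulLog_walk_le o s x y
  refine le_trans ?_ h2
  rw [h1, Finset.sum_div, ← Finset.sum_add_distrib]
  refine Finset.sum_le_sum fun e _ => ?_
  -- The doubled midpoint gain has constant `1/6`; Cauchy–Schwarz costs a factor 2, which leaves
  -- `1/12`.
  have h3 := sq_sum_abs_sub_le _ _ (hW (o.tail e)) (hW (o.head e))
    (sum_walk_pow_le_one o s _) (sum_walk_pow_le_one o s _)
  have h4 : ∑ y, (Real.negMulLog ((walk o ^ s) (o.tail e) y) +
      Real.negMulLog ((walk o ^ s) (o.head e) y)) +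
      (∑ y, ((walk o ^ s) (o.tail e) y - (walk o ^ s) (o.head e) y) ^ 2 /
        ((walk o ^ s) (o.tail e) y + (walk o ^ s) (o.head e) y)) / 6 ≤
      ∑ y, 2 *
      Real.negMulLog (((walk o ^ s) (o.tail e) y + (walk o ^ s) (o.head e) y) / 2) := by
    rw [Finset.sum_div, ← Finset.sum_add_distrib]
    refine Finset.sum_le_sum fun y _ => ?_
    have := negMulLog_midpoint (hW (o.tail e) y) (hW (o.head e) y)
    linarith
  simp only [variation, edgeWalk_apply]
  linarith

/-- Telescoping: the entropy starts at zero and stays below `2 |E| (log n + 1)`, as the degrees sum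
to `2 |E|`. -/
theorem sum_variation_sq_le (o : Orientation G) (S : ℕ) :
    ∑ s ∈ Finset.range S, ∑ e, variation o s e ^ 2 ≤
      24 * (Real.log (Fintype.card V) + 1) * Fintype.card G.edgeSet := by
  have h1 : ∀ S, (∑ s ∈ Finset.range S, ∑ e, variation o s e ^ 2) / 12 ≤ walkEntropy o S := by
    intro S
    induction S with
    | zero =>
      have h0 : ∀ x y : V, Real.negMulLog ((1 : Matrix V V ℝ) x y) = 0 := by
        intro x y
        rw [Matrix.one_apply]
        split_ifs <;> simp
      simp [walkEntropy, h0]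
    | succ S ih =>
      rw [Finset.sum_range_succ, add_div]
      linarith [walkEntropy_succ o S]
  have h2 : walkEntropy o S ≤ ∑ x, deg o x * (Real.log (Fintype.card V) + 1) :=
    Finset.sum_le_sum fun x _ => mul_le_mul_of_nonneg_left
      (sum_negMulLog_le _ (walk_pow_nonneg o S x) (sum_walk_pow_le_one o S x)) (deg_nonneg o x)
  rw [sum_deg_mul o fun _ => _, Finset.sum_const, Finset.card_univ, nsmul_eq_mul] at h2
  linarith [h1 S]

/-! ### Invariance under automorphisms -/

/-- An automorphism may reverse the chosen orientation, so only unsigned quantities are invariant.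
-/
theorem exists_edge_map (o : Orientation G) (φ : G ≃g G) : ∃ ψ : G.edgeSet ≃ G.edgeSet,
    (∀ e, (ψ e : Sym2 V) = Sym2.map φ e) ∧
    ∀ e, (o.tail (ψ e) = φ (o.tail e) ∧ o.head (ψ e) = φ (o.head e)) ∨
      (o.tail (ψ e) = φ (o.head e) ∧ o.head (ψ e) = φ (o.tail e)) := by
  refine ⟨φ.mapEdgeSet, fun e => rfl, fun e => ?_⟩
  have h := o.mk_eq (φ.mapEdgeSet e)
  have h2 : ((φ.mapEdgeSet e : G.edgeSet) : Sym2 V) = Sym2.map φ e := rfl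
  rw [h2, ← o.mk_eq e, Sym2.map_mk] at h
  simpa using h

theorem unsignedIncidence_map (o : Orientation G) (φ : G ≃g G) {e f : G.edgeSet}
    (h : (o.tail f = φ (o.tail e) ∧ o.head f = φ (o.head e)) ∨
      (o.tail f = φ (o.head e) ∧ o.head f = φ (o.tail e))) (x : V) :
    unsignedIncidence o f (φ x) = unsignedIncidence o e x := by
  rcases h with ⟨h1, h2⟩ | ⟨h1, h2⟩
  · simp [unsignedIncidence_apply, h1, h2]
  · simp [unsignedIncidence_apply, h1, h2, add_comm]

theorem deg_map (o : Orientation G) (φ : G ≃g G) (x : V) : deg o (φ x) = deg o x := by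
  obtain ⟨ψ, -, hψ⟩ := exists_edge_map o φ
  rw [deg, ← ψ.sum_comp]
  exact Finset.sum_congr rfl fun e _ => unsignedIncidence_map o φ (hψ e) x

theorem walk_pow_map (o : Orientation G) (φ : G ≃g G) (s : ℕ) (x y : V) :
    (walk o ^ s) (φ x) (φ y) = (walk o ^ s) x y := by
  induction s generalizing x with
  | zero => simp [Matrix.one_apply]
  | succ s ih =>
    obtain ⟨ψ, -, hψ⟩ := exists_edge_map o φ
    rw [walk_pow_succ_apply, walk_pow_succ_apply, deg_map, ← ψ.sum_comp]
    congr 1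
    refine Finset.sum_congr rfl fun e _ => ?_
    rw [unsignedIncidence_map o φ (hψ e)]
    rcases hψ e with ⟨h1, h2⟩ | ⟨h1, h2⟩
    · rw [h1, h2, ih, ih]
    · rw [h1, h2, ih, ih, add_comm]

theorem abs_edgeWalk_map (o : Orientation G) (φ : G ≃g G) {e f : G.edgeSet}
    (h : (o.tail f = φ (o.tail e) ∧ o.head f = φ (o.head e)) ∨
      (o.tail f = φ (o.head e) ∧ o.head f = φ (o.tail e))) (s : ℕ) (x : V) :
    |edgeWalk o s f (φ x)| = |edgeWalk o s e x| := by
  rcases h with ⟨h1, h2⟩ | ⟨h1, h2⟩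
  · simp only [edgeWalk_apply, h1, h2, walk_pow_map]
  · simp only [edgeWalk_apply, h1, h2, walk_pow_map, abs_sub_comm]

/-- The total variation at a vertex over all edges. -/
def vertexVariation (o : Orientation G) (s : ℕ) (x : V) : ℝ := ∑ e, |edgeWalk o s e x|

theorem vertexVariation_map (o : Orientation G) (φ : G ≃g G) (s : ℕ) (x : V) :
    vertexVariation o s (φ x) = vertexVariation o s x := by
  obtain ⟨ψ, -, hψ⟩ := exists_edge_map o φ
  rw [vertexVariation, ← ψ.sum_comp]
  exact Finset.sum_congr rfl fun e _ => abs_edgeWalk_map o φ (hψ e) s x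

theorem EdgeTransitive.exists_map (hG : EdgeTransitive G) (o : Orientation G) (e f : G.edgeSet) :
    ∃ φ : G ≃g G, (o.tail f = φ (o.tail e) ∧ o.head f = φ (o.head e)) ∨
      (o.tail f = φ (o.head e) ∧ o.head f = φ (o.tail e)) := by
  obtain ⟨φ, hφ⟩ := hG e e.2 f f.2
  obtain ⟨ψ, h1, h2⟩ := exists_edge_map o φ
  obtain rfl : ψ e = f := Subtype.ext ((h1 e).trans hφ)
  exact ⟨φ, h2 e⟩

theorem variation_eq (hG : EdgeTransitive G) (o : Orientation G) (s : ℕ) (e f : G.edgeSet) :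
    variation o s f = variation o s e := by
  obtain ⟨φ, hφ⟩ := hG.exists_map o e f
  rw [variation, ← φ.toEquiv.sum_comp]
  exact Finset.sum_congr rfl fun x _ => abs_edgeWalk_map o φ hφ s x

/-- The graph need not be vertex-transitive, but the ratio `g` is automorphism-invariant, so its sum
over the ends of an edge is a constant `c`. Double counting gives `|E| c ≤ |E| v_s`, and each end
has `g ≤ c`. -/
theorem vertexVariation_le (hG : EdgeTransitive G) (o : Orientation G) (s : ℕ) (e : G.edgeSet)
    {x : V} (hx : deg o x ≠ 0) : vertexVariation o s x ≤ deg o x * variation o s e := by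
  set g : V → ℝ := fun y => vertexVariation o s y / deg o y with hg
  have hv0 : ∀ y, 0 ≤ vertexVariation o s y := fun y => Finset.sum_nonneg fun _ _ => abs_nonneg _
  have hg0 : ∀ y, 0 ≤ g y := fun y => div_nonneg (hv0 y) (deg_nonneg o y)
  have hgφ : ∀ (φ : G ≃g G) y, g (φ y) = g y := fun φ y => by
    simp only [hg, vertexVariation_map, deg_map]
  obtain ⟨f, hf⟩ := exists_endpoint_of_deg_ne_zero o hx
  have hsum : ∀ f', g (o.tail f') + g (o.head f') = g (o.tail f) + g (o.head f) := by
    intro f'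
    obtain ⟨φ, ⟨h1, h2⟩ | ⟨h1, h2⟩⟩ := hG.exists_map o f f'
    · rw [h1, h2, hgφ, hgφ]
    · rw [h1, h2, hgφ, hgφ, add_comm]
  have h1 : ∑ y, deg o y * g y ≤ ∑ y, vertexVariation o s y := by
    refine Finset.sum_le_sum fun y _ => ?_
    rcases eq_or_ne (deg o y) 0 with h | h
    · rw [h, zero_mul]; exact hv0 y
    · rw [mul_div_cancel₀ _ h]
  have h2 : ∑ y, vertexVariation o s y = ∑ f', variation o s f' := Finset.sum_comm
  rw [h2, sum_deg_mul] at h1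
  simp only [hsum, variation_eq hG o s e, Finset.sum_const, nsmul_eq_mul] at h1
  have hcard : (0 : ℝ) < (Finset.univ : Finset G.edgeSet).card := by
    exact_mod_cast Finset.card_pos.2 ⟨f, Finset.mem_univ f⟩
  have h3 := le_of_mul_le_mul_left h1 hcard
  have h4 : g x ≤ variation o s e := by
    rcases hf with rfl | rfl
    · linarith [hg0 (o.head f)]
    · linarith [hg0 (o.tail f)]
  have hpos := (deg_nonneg o x).lt_of_ne' hx
  rw [hg] at h4
  simp only at h4
  rwa [div_le_iff₀ hpos, mul_comm] at h4

theorem sum_variation_sq_le_log (hG : EdgeTransitive G) (o : Orientation G) (e : G.edgeSet)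
    (S : ℕ) :
    ∑ s ∈ Finset.range S, variation o s e ^ 2 ≤ 24 * (Real.log (Fintype.card V) + 1) := by
  have h := sum_variation_sq_le o S
  simp only [variation_eq hG o _ e, Finset.sum_const, nsmul_eq_mul, Finset.card_univ,
    ← Finset.mul_sum] at h
  have hcard : (0 : ℝ) < Fintype.card G.edgeSet := by
    exact_mod_cast Fintype.card_pos_iff.2 ⟨e⟩
  rw [mul_comm] at h
  exact le_of_mul_le_mul_right h hcard

/-! ### Matrix identities -/

theorem IsMoorePenrose.transpose {m n : Type*} [Fintype m] [Fintype n]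
    {A : Matrix m n ℝ} {X : Matrix n m ℝ} (h : IsMoorePenrose A X) : IsMoorePenrose Aᵀ Xᵀ where
  mul_mul_self := by
    rw [← Matrix.transpose_mul, ← Matrix.transpose_mul, ← Matrix.mul_assoc, h.mul_mul_self]
  self_mul_mul := by
    rw [← Matrix.transpose_mul, ← Matrix.transpose_mul, ← Matrix.mul_assoc, h.self_mul_mul]
  symm_left := by rw [← Matrix.transpose_mul, h.symm_right, h.symm_right]
  symm_right := by rw [← Matrix.transpose_mul, h.symm_left, h.symm_left]

theorem laplacianPinv_spec (o : Orientation G) :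
    IsMoorePenrose (laplacian o) (laplacianPinv o) :=
  pinv_spec _ _

theorem laplacian_transpose (o : Orientation G) : (laplacian o)ᵀ = laplacian o := by
  simp [laplacian, Matrix.transpose_mul]

theorem laplacianPinv_transpose (o : Orientation G) : (laplacianPinv o)ᵀ = laplacianPinv o := by
  have h := (laplacianPinv_spec o).transpose
  rw [laplacian_transpose] at h
  exact h.unique (laplacianPinv_spec o)

theorem transferImpedance_transpose (o : Orientation G) :
    (transferImpedance o)ᵀ = transferImpedance o := by
  rw [transferImpedance, Matrix.transpose_mul, Matrix.transpose_mul, Matrix.transpose_transpose,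
    laplacianPinv_transpose, Matrix.mul_assoc]

theorem eq_zero_of_transpose_mul_self {m n : Type*} [Fintype m] [Fintype n] {A : Matrix m n ℝ}
    (h : Aᵀ * A = 0) : A = 0 := by
  rw [← Matrix.conjTranspose_eq_transpose_of_trivial] at h
  exact Matrix.conjTranspose_mul_self_eq_zero.1 h

/-- The transfer impedance matrix fixes the cut space. -/
theorem transferImpedance_mul_incidence (o : Orientation G) :
    transferImpedance o * incidence o = incidence o := by
  rw [← sub_eq_zero]
  -- The difference is `B (L⁺ L - 1)` and is killed by `Bᵀ` because `L L⁺ L = L`.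
  apply eq_zero_of_transpose_mul_self
  have h : (incidence o)ᵀ * (transferImpedance o * incidence o - incidence o) = 0 := by
    have := (laplacianPinv_spec o).mul_mul_self
    rw [Matrix.mul_sub, sub_eq_zero]
    simpa only [laplacian, transferImpedance, Matrix.mul_assoc] using this
  have h2 : transferImpedance o * incidence o - incidence o =
      incidence o * (laplacianPinv o * laplacian o - 1) := by
    rw [Matrix.mul_sub, Matrix.mul_one]
    simp only [laplacian, transferImpedance, Matrix.mul_assoc]
  nth_rewrite 1 [h2]
  rw [Matrix.transpose_mul, Matrix.mul_assoc, h, Matrix.mul_zero]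

theorem incidence_transpose_mul_transferImpedance (o : Orientation G) :
    (incidence o)ᵀ * transferImpedance o = (incidence o)ᵀ := by
  rw [← transferImpedance_transpose, ← Matrix.transpose_mul, transferImpedance_mul_incidence]

/-- The electrical flow is the image of any unit flow under the transfer impedance matrix. -/
theorem IsUnitFlow.electricalFlow_eq {o : Orientation G} {s t : V} {g : G.edgeSet → ℝ}
    (h : IsUnitFlow o s t g) : electricalFlow o s t = transferImpedance o *ᵥ g := by
  rw [electricalFlow, ← h, transferImpedance, Matrix.mulVec_mulVec, Matrix.mulVec_mulVec,
    Matrix.mul_assoc]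

theorem exists_isUnitFlow_of_adj (o : Orientation G) {s t : V} (h : G.Adj s t) :
    ∃ g, IsUnitFlow o s t g := by
  have hB : ∀ e : G.edgeSet,
      (incidence o)ᵀ *ᵥ Pi.single e 1 = demandVec (o.tail e) (o.head e) := by
    intro e
    rw [Matrix.mulVec_single_one]
    rfl
  have h2 := o.mk_eq ⟨s(s, t), h⟩
  rw [Sym2.eq_iff] at h2
  rcases h2 with ⟨h1, h2⟩ | ⟨h1, h2⟩
  · exact ⟨Pi.single ⟨s(s, t), h⟩ 1, by rw [IsUnitFlow, hB, h1, h2]⟩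
  · refine ⟨-Pi.single ⟨s(s, t), h⟩ 1, ?_⟩
    rw [IsUnitFlow, Matrix.mulVec_neg, hB, h1, h2, demandVec, demandVec, neg_sub]

theorem exists_isUnitFlow (o : Orientation G) {s t : V} (h : G.Reachable s t) :
    ∃ g, IsUnitFlow o s t g := by
  obtain ⟨p⟩ := h
  induction p with
  | nil => exact ⟨0, by simp [IsUnitFlow, demandVec]⟩
  | cons hadj _ ih =>
    obtain ⟨g, hg⟩ := ih
    obtain ⟨g', hg'⟩ := exists_isUnitFlow_of_adj o hadj
    refine ⟨g' + g, ?_⟩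
    rw [IsUnitFlow, Matrix.mulVec_add, hg, hg', demandVec, demandVec, demandVec, sub_add_sub_cancel]

theorem isObliviousRouting_electricalFlow (o : Orientation G) :
    IsObliviousRouting o (electricalFlow o) := by
  intro s t h
  obtain ⟨g, hg⟩ := exists_isUnitFlow o h
  rw [hg.electricalFlow_eq, IsUnitFlow, Matrix.mulVec_mulVec,
    incidence_transpose_mul_transferImpedance]
  exact hg

/-- The competitive ratio is bounded by the column sums of the transfer impedance matrix. -/
theorem competitiveRatioLE_of_sum_abs_le {o : Orientation G} {α : ℝ}
    (h : ∀ e, ∑ f, |transferImpedance o f e| ≤ α) :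
    CompetitiveRatioLE o (electricalFlow o) α := by
  intro k s t g hg
  rcases isEmpty_or_nonempty G.edgeSet with hE | hE
  -- Both suprema are over the empty type, hence 0, whatever the sign of `α`.
  · simp [congestion, Real.iSup_of_isEmpty]
  have hle : ∀ e, ∑ i, |g i e| ≤ congestion g := fun e =>
    le_ciSup (f := fun e => ∑ i, |g i e|) (Set.finite_range _).bddAbove e
  have h0 : 0 ≤ congestion g :=
    Real.iSup_nonneg fun e => Finset.sum_nonneg fun i _ => abs_nonneg _
  refine ciSup_le fun e => ?_
  calc ∑ i, |electricalFlow o (s i) (t i) e|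
      ≤ ∑ i, ∑ f, |transferImpedance o e f| * |g i f| := by
        refine Finset.sum_le_sum fun i _ => ?_
        rw [(hg i).electricalFlow_eq]
        refine (Finset.abs_sum_le_sum_abs _ _).trans (le_of_eq ?_)
        simp only [abs_mul]
    _ = ∑ f, |transferImpedance o e f| * ∑ i, |g i f| := by
        rw [Finset.sum_comm]
        simp only [Finset.mul_sum]
    _ ≤ ∑ f, |transferImpedance o e f| * congestion g :=
        Finset.sum_le_sum fun f _ => mul_le_mul_of_nonneg_left (hle f) (abs_nonneg _)
    _ = (∑ f, |transferImpedance o f e|) * congestion g := by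
        rw [← Finset.sum_mul]
        conv_lhs => rw [← transferImpedance_transpose]
        rfl
    _ ≤ α * congestion g := mul_le_mul_of_nonneg_right (h e) h0

/-! ### The geometric series for `Π` -/

/-- The inverse degree matrix. -/
def invDeg (o : Orientation G) : Matrix V V ℝ := Matrix.diagonal fun x => (deg o x)⁻¹

/-- The normalised edge Laplacian `½ B D⁻¹ Bᵀ`. -/
def edgeLaplacian (o : Orientation G) : Matrix G.edgeSet G.edgeSet ℝ :=
  (1 / 2 : ℝ) • (incidence o * invDeg o * (incidence o)ᵀ)

theorem walk_eq (o : Orientation G) :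
    walk o = (1 / 2 : ℝ) • (invDeg o * ((unsignedIncidence o)ᵀ * unsignedIncidence o)) := by
  rw [walk, ← Matrix.smul_mul, invDeg, ← Matrix.diagonal_smul]
  congr 2
  ext x
  simp [mul_comm]

/-- The two summands are degree plus adjacency and degree minus adjacency. Off isolated vertices
this says `W = 1 - ½ D⁻¹ L`. -/
theorem unsigned_add_signed (o : Orientation G) :
    (unsignedIncidence o)ᵀ * unsignedIncidence o + (incidence o)ᵀ * incidence o =
      Matrix.diagonal fun x => 2 * deg o x := by
  ext x y
  simp only [Matrix.add_apply, Matrix.mul_apply, Matrix.transpose_apply, Matrix.diagonal_apply,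
    ← Finset.sum_add_distrib]
  have key : ∀ e, unsignedIncidence o e x * unsignedIncidence o e y +
      incidence o e x * incidence o e y =
      if x = y then 2 * unsignedIncidence o e x else 0 := by
    intro e
    have := o.tail_ne_head e
    simp only [unsignedIncidence_apply, incidence_apply]
    rcases eq_or_ne x y with rfl | hxy
    · rcases eq_or_ne (o.tail e) x with h1 | h1 <;> rcases eq_or_ne (o.head e) x with h2 | h2 <;>
        simp_all <;> norm_num
    · rw [if_neg hxy]
      split_ifs <;> simp_all
  simp only [key]
  split_ifs
  · rw [deg, Finset.mul_sum]
  · simp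

theorem incidence_mul_invDeg_mul_deg (o : Orientation G) :
    incidence o * (invDeg o * Matrix.diagonal fun x => 2 * deg o x) = (2 : ℝ) • incidence o := by
  rw [invDeg, Matrix.diagonal_mul_diagonal]
  ext e x
  rw [Matrix.mul_diagonal, Matrix.smul_apply, smul_eq_mul]
  rcases eq_or_ne (deg o x) 0 with h | h
  · rw [incidence_eq_zero o h]; simp
  · field_simp

theorem one_sub_edgeLaplacian_mul_incidence (o : Orientation G) :
    (1 - edgeLaplacian o) * incidence o = incidence o * walk o := by
  have h := incidence_mul_invDeg_mul_deg o
  rw [← unsigned_add_signed, Matrix.mul_add, Matrix.mul_add] at h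
  rw [Matrix.sub_mul, Matrix.one_mul, edgeLaplacian, walk_eq, Matrix.smul_mul, Matrix.mul_smul,
    sub_eq_iff_eq_add, ← smul_add, Matrix.mul_assoc, Matrix.mul_assoc, h, smul_smul]
  norm_num

theorem one_sub_edgeLaplacian_pow_mul_incidence (o : Orientation G) (s : ℕ) :
    (1 - edgeLaplacian o) ^ s * incidence o = edgeWalk o s := by
  induction s with
  | zero => simp [edgeWalk]
  | succ s ih =>
    rw [pow_succ', Matrix.mul_assoc, ih, edgeWalk, ← Matrix.mul_assoc,
      one_sub_edgeLaplacian_mul_incidence, Matrix.mul_assoc, ← pow_succ', edgeWalk]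

theorem edgeLaplacian_transpose (o : Orientation G) : (edgeLaplacian o)ᵀ = edgeLaplacian o := by
  simp [edgeLaplacian, invDeg, Matrix.transpose_mul, Matrix.mul_assoc]

/-- As `M` is symmetric, the power can be split across its two factors `B` and `Bᵀ`, turning each
into a walk difference. -/
theorem edgeLaplacian_mul_pow (o : Orientation G) (s r : ℕ) :
    edgeLaplacian o * (1 - edgeLaplacian o) ^ (s + r) =
      (1 / 2 : ℝ) • (edgeWalk o s * invDeg o * (edgeWalk o r)ᵀ) := by
  have hc : Commute (edgeLaplacian o) ((1 - edgeLaplacian o) ^ s) :=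
    ((Commute.one_right _).sub_right (Commute.refl _)).pow_right s
  rw [pow_add, ← mul_assoc, hc.eq, ← one_sub_edgeLaplacian_pow_mul_incidence o s,
    ← one_sub_edgeLaplacian_pow_mul_incidence o r, Matrix.transpose_mul, Matrix.transpose_pow,
    Matrix.transpose_sub, Matrix.transpose_one, edgeLaplacian_transpose]
  nth_rewrite 2 [edgeLaplacian]
  simp only [Matrix.mul_smul, Matrix.smul_mul, Matrix.mul_assoc]

theorem transferImpedance_mul_edgeLaplacian (o : Orientation G) :
    transferImpedance o * edgeLaplacian o = edgeLaplacian o := by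
  rw [edgeLaplacian, Matrix.mul_smul, ← Matrix.mul_assoc, ← Matrix.mul_assoc,
    transferImpedance_mul_incidence]

/-- Iterates `Π (1 - M) = Π - M`. -/
theorem transferImpedance_eq_sum_add (o : Orientation G) (T : ℕ) :
    transferImpedance o = ∑ t ∈ Finset.range T, edgeLaplacian o * (1 - edgeLaplacian o) ^ t +
      transferImpedance o * (1 - edgeLaplacian o) ^ T := by
  induction T with
  | zero => simp
  | succ T ih =>
    rw [Finset.sum_range_succ, pow_succ', ← Matrix.mul_assoc, Matrix.mul_sub, Matrix.mul_one,
      transferImpedance_mul_edgeLaplacian, Matrix.sub_mul, add_assoc, add_sub_cancel]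
    exact ih

/-- `M` and `Bᵀ` have the same kernel, so `Bᵀ` factors through `M`. The remainder `Π (1 - M)^T` then
becomes `K M (1 - M)^T`, whose decay follows from that of `v_s` without a spectral gap. -/
theorem exists_transferImpedance_eq_mul_edgeLaplacian (o : Orientation G) :
    ∃ K, transferImpedance o = K * edgeLaplacian o := by
  have hH : (edgeLaplacian o).IsHermitian := by
    rw [Matrix.IsHermitian, Matrix.conjTranspose_eq_transpose_of_trivial, edgeLaplacian_transpose]
  obtain ⟨X, hX⟩ := exists_isMoorePenrose (edgeLaplacian o) hH
  set Z := X * edgeLaplacian o - 1 with hZ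
  have h0 : edgeLaplacian o * Z = 0 := by
    rw [hZ, Matrix.mul_sub, Matrix.mul_one, ← Matrix.mul_assoc, hX.mul_mul_self, sub_self]
  have h1 : incidence o * invDeg o * (incidence o)ᵀ * Z = 0 := by
    rw [edgeLaplacian, Matrix.smul_mul] at h0
    exact (smul_eq_zero.1 h0).resolve_left (by norm_num)
  set Q : Matrix V V ℝ := Matrix.diagonal fun x => √((deg o x)⁻¹) with hQ
  have hQQ : Q * Q = invDeg o := by
    rw [hQ, Matrix.diagonal_mul_diagonal, invDeg]
    congr 1
    ext x
    exact Real.mul_self_sqrt (inv_nonneg.2 (deg_nonneg o x))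
  have h2 : Q * ((incidence o)ᵀ * Z) = 0 := by
    apply eq_zero_of_transpose_mul_self
    have : Qᵀ = Q := Matrix.diagonal_transpose _
    rw [Matrix.transpose_mul, Matrix.transpose_mul, Matrix.transpose_transpose, this,
      Matrix.mul_assoc, ← Matrix.mul_assoc Q, hQQ, Matrix.mul_assoc, ← Matrix.mul_assoc (invDeg o),
      ← Matrix.mul_assoc (incidence o), ← Matrix.mul_assoc (incidence o), h1, Matrix.mul_zero]
  have h3 : (incidence o)ᵀ * Z = 0 := by
    -- `Q = D^(-1/2)` can be undone here, since `Bᵀ` has zero rows at the isolated vertices where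
    -- `Q` vanishes.
    have h5 : (2 : ℝ) • (incidence o)ᵀ =
        (Matrix.diagonal fun x => 2 * deg o x) * (Q * (Q * (incidence o)ᵀ)) := by
      rw [← Matrix.transpose_smul, ← incidence_mul_invDeg_mul_deg, ← Matrix.mul_assoc Q, hQQ, invDeg]
      simp only [Matrix.transpose_mul, Matrix.diagonal_transpose, Matrix.mul_assoc]
    have h6 : (2 : ℝ) • (incidence o)ᵀ * Z = 0 := by
      rw [h5, Matrix.mul_assoc, Matrix.mul_assoc, Matrix.mul_assoc, h2, Matrix.mul_zero,
        Matrix.mul_zero]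
    rw [Matrix.smul_mul] at h6
    exact (smul_eq_zero.1 h6).resolve_left (by norm_num)
  refine ⟨incidence o * laplacianPinv o * (incidence o)ᵀ * X, ?_⟩
  rw [hZ, Matrix.mul_sub, Matrix.mul_one, sub_eq_zero] at h3
  rw [Matrix.mul_assoc, Matrix.mul_assoc (incidence o * laplacianPinv o), h3, transferImpedance]

/-! ### Column sums -/

/-- Summing over `f` first gives at most `deg x * v_s` at each vertex, which cancels `D⁻¹`; the sum
over `x` is then `v_r`. -/
theorem sum_abs_edgeLaplacian_mul_pow_le (hG : EdgeTransitive G) (o : Orientation G) (s r : ℕ)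
    (e : G.edgeSet) :
    ∑ f, |(edgeLaplacian o * (1 - edgeLaplacian o) ^ (s + r)) f e| ≤
      variation o s e * variation o r e / 2 := by
  have h1 : ∀ f, |(edgeLaplacian o * (1 - edgeLaplacian o) ^ (s + r)) f e| ≤
      1 / 2 * ∑ x, |edgeWalk o s f x| * ((deg o x)⁻¹ * |edgeWalk o r e x|) := by
    intro f
    rw [edgeLaplacian_mul_pow, Matrix.smul_apply, smul_eq_mul, abs_mul, abs_of_pos one_half_pos,
      Matrix.mul_apply]
    refine mul_le_mul_of_nonneg_left ((Finset.abs_sum_le_sum_abs _ _).trans (le_of_eq ?_))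
      one_half_pos.le
    refine Finset.sum_congr rfl fun x _ => ?_
    rw [invDeg, Matrix.mul_diagonal, Matrix.transpose_apply, abs_mul, abs_mul,
      abs_of_nonneg (inv_nonneg.2 (deg_nonneg o x)), mul_assoc]
  calc _ ≤ ∑ f, 1 / 2 * ∑ x, |edgeWalk o s f x| * ((deg o x)⁻¹ * |edgeWalk o r e x|) :=
        Finset.sum_le_sum fun f _ => h1 f
    _ = 1 / 2 * ∑ x, vertexVariation o s x * ((deg o x)⁻¹ * |edgeWalk o r e x|) := by
        rw [← Finset.mul_sum, Finset.sum_comm]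
        simp only [vertexVariation, Finset.sum_mul]
    _ ≤ 1 / 2 * ∑ x, variation o s e * |edgeWalk o r e x| := by
        refine mul_le_mul_of_nonneg_left (Finset.sum_le_sum fun x _ => ?_) one_half_pos.le
        rcases eq_or_ne (deg o x) 0 with h | h
        · rw [h, inv_zero, zero_mul, mul_zero]
          exact mul_nonneg (variation_nonneg o s e) (abs_nonneg _)
        · rw [← mul_assoc]
          refine mul_le_mul_of_nonneg_right ?_ (abs_nonneg _)
          rw [← div_eq_mul_inv, div_le_iff₀ ((deg_nonneg o x).lt_of_ne' h), mul_comm]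
          exact vertexVariation_le hG o s e h
    _ = _ := by
        rw [← Finset.mul_sum, variation, variation]
        ring

/-- Split `t = 2s` as `s + s` and `t = 2s + 1` as `s + (s + 1)`, then apply AM–GM. -/
theorem sum_abs_partial_sum_le (hG : EdgeTransitive G) (o : Orientation G) (S : ℕ)
    (e : G.edgeSet) :
    ∑ f, |(∑ t ∈ Finset.range (S + S), edgeLaplacian o * (1 - edgeLaplacian o) ^ t) f e| ≤
      ∑ s ∈ Finset.range (S + 1), variation o s e ^ 2 := by
  -- The last term telescopes: AM–GM gives `¾ v_s² + ¼ v_(s+1)²` per pair, and it corrects this to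
  -- equal weights.
  have h1 : ∀ S, ∑ t ∈ Finset.range (S + S),
      ∑ f, |(edgeLaplacian o * (1 - edgeLaplacian o) ^ t) f e| ≤
      ∑ s ∈ Finset.range S, (variation o s e ^ 2 + variation o (s + 1) e ^ 2) / 2 +
        (variation o 0 e ^ 2 - variation o S e ^ 2) / 4 := by
    intro S
    induction S with
    | zero => simp
    | succ S ih =>
      rw [show S + 1 + (S + 1) = S + S + 1 + 1 by ring, Finset.sum_range_succ,
        Finset.sum_range_succ, Finset.sum_range_succ]
      have h2 := sum_abs_edgeLaplacian_mul_pow_le hG o S S e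
      have h3 := sum_abs_edgeLaplacian_mul_pow_le hG o S (S + 1) e
      rw [← add_assoc] at h3
      nlinarith [sq_nonneg (variation o S e - variation o (S + 1) e)]
  have h2 : ∀ S, ∑ s ∈ Finset.range S, (variation o s e ^ 2 + variation o (s + 1) e ^ 2) / 2 +
        (variation o 0 e ^ 2 - variation o S e ^ 2) / 4 ≤
      ∑ s ∈ Finset.range (S + 1), variation o s e ^ 2 := by
    intro S
    have h3 := Finset.sum_range_succ (fun s => variation o s e ^ 2) S
    have h4 := Finset.sum_range_succ' (fun s => variation o s e ^ 2) S
    rw [← Finset.sum_div, Finset.sum_add_distrib]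
    linarith [sq_nonneg (variation o 0 e), sq_nonneg (variation o S e)]
  refine le_trans ?_ ((h1 S).trans (h2 S))
  rw [Finset.sum_comm]
  refine Finset.sum_le_sum fun f _ => ?_
  rw [Matrix.sum_apply]
  exact Finset.abs_sum_le_sum_abs _ _

theorem tendsto_variation_sq (hG : EdgeTransitive G) (o : Orientation G) (e : G.edgeSet) :
    Filter.Tendsto (fun s => variation o s e ^ 2) Filter.atTop (nhds 0) :=
  (summable_of_sum_range_le (fun _ => sq_nonneg _)
    (sum_variation_sq_le_log hG o e)).tendsto_atTop_zero

theorem sum_abs_transferImpedance_le (hG : EdgeTransitive G) (o : Orientation G)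
    (e : G.edgeSet) :
    ∑ f, |transferImpedance o f e| ≤ 24 * (Real.log (Fintype.card V) + 1) := by
  obtain ⟨K, hK⟩ := exists_transferImpedance_eq_mul_edgeLaplacian o
  have h1 : ∀ S, ∑ f, |transferImpedance o f e| ≤ 24 * (Real.log (Fintype.card V) + 1) +
      (∑ f, ∑ g, |K f g|) * (variation o S e ^ 2 / 2) := by
    intro S
    have htail : ∑ f, |(transferImpedance o * (1 - edgeLaplacian o) ^ (S + S)) f e| ≤
        (∑ f, ∑ g, |K f g|) * (variation o S e ^ 2 / 2) := by
      rw [hK, Matrix.mul_assoc, Finset.sum_mul]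
      refine Finset.sum_le_sum fun f _ => ?_
      rw [Matrix.mul_apply, Finset.sum_mul]
      refine (Finset.abs_sum_le_sum_abs _ _).trans (Finset.sum_le_sum fun g _ => ?_)
      rw [abs_mul]
      refine mul_le_mul_of_nonneg_left ?_ (abs_nonneg _)
      have h := sum_abs_edgeLaplacian_mul_pow_le hG o S S e
      rw [← sq] at h
      exact (Finset.single_le_sum (f := fun g =>
        |(edgeLaplacian o * (1 - edgeLaplacian o) ^ (S + S)) g e|)
        (fun _ _ => abs_nonneg _) (Finset.mem_univ g)).trans h
    have hmain := (sum_abs_partial_sum_le hG o S e).trans (sum_variation_sq_le_log hG o e (S + 1))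
    refine le_trans ?_ (add_le_add hmain htail)
    rw [← Finset.sum_add_distrib]
    refine Finset.sum_le_sum fun f _ => ?_
    conv_lhs => rw [transferImpedance_eq_sum_add o (S + S), Matrix.add_apply]
    exact abs_add_le _ _
  have h2 := (((tendsto_variation_sq hG o e).div_const 2).const_mul
    (∑ f, ∑ g, |K f g|)).const_add (24 * (Real.log (Fintype.card V) + 1))
  simpa using ge_of_tendsto' h2 h1

end

end ElectricalRouting

end

theorem mainTheorem5 :
    ∃ C : ℝ, 0 < C ∧
      ∀ (V : Type*) [Fintype V] [DecidableEq V] (G : SimpleGraph V) [Fintype G.edgeSet],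
        ElectricalRouting.EdgeTransitive G →
        ∀ o : ElectricalRouting.Orientation G,
          ElectricalRouting.IsObliviousRouting o (ElectricalRouting.electricalFlow o) ∧
          ElectricalRouting.CompetitiveRatioLE o (ElectricalRouting.electricalFlow o)
            (C * Real.log (Fintype.card V) ^ 2) ∧
          ∀ e : G.edgeSet, ∑ f : G.edgeSet, |ElectricalRouting.transferImpedance o f e|
            ≤ C * Real.log (Fintype.card V) ^ 2 := by
  -- An edge forces `n ≥ 2`, so `log n > 0.69` and `24 (log n + 1) ≤ 144 log² n`.
  refine ⟨144, by norm_num, fun V _ _ G _ hG o => ?_⟩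
  have h : ∀ e : G.edgeSet, ∑ f : G.edgeSet, |ElectricalRouting.transferImpedance o f e|
      ≤ 144 * Real.log (Fintype.card V) ^ 2 := by
    intro e
    have hcard : (2 : ℝ) ≤ Fintype.card V := by
      exact_mod_cast Fintype.one_lt_card_iff.2 ⟨_, _, o.tail_ne_head e⟩
    have hlog := Real.log_le_log (by norm_num) hcard
    have hlog2 := Real.log_two_gt_d9
    refine (ElectricalRouting.sum_abs_transferImpedance_le hG o e).trans ?_
    nlinarith
  exact ⟨ElectricalRouting.isObliviousRouting_electricalFlow o,
    ElectricalRouting.competitiveRatioLE_of_sum_abs_le h, h⟩
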